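/- Let $H_1\neq H_2$ be two-dimensional linear subspaces of $\mathbb{R}^3$, let $\mathbf v_1,\dots,\mathbf v_n\in H_1$ and $\mathbf w_1,\dots,\mathbf w_m\in H_2$, and let $P=[\mathbf v_1]+\dots+[\mathbf v_n]+[\mathbf w_1]+\dots+[\mathbf w_m]$ be the Minkowski sum of the segments $[\mathbf u]=\{t\mathbf u: 0\le t\le 1\}$ (a two-flat zonotope). Assume that $P$ has non-empty interior, that the additive group generated by $\mathbf v_1,\dots,\mathbf v_n,\mathbf w_1,\dots,\mathbf w_m$ is discrete, and that $\mathbf v_1,\dots,\mathbf v_n$ span $H_1$. Then there are an integer $k\ge 1$ and a discrete set $\Lambda\subseteq\mathbb{R}^3$ (one with finitely many points in every bounded region) such that almost every point of $\mathbb{R}^3$ lies in exactly $k$ of the translates $P+\lambda$, $\lambda\in\Lambda$, and $\Lambda$ is not a finite union of translated lattices. Here a lattice is a discrete additive subgroup of $\mathbb{R}^3$ of any rank, and the lattices in the union need not have the same rank. -/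

import Mathlib

open MeasureTheory
open scoped Pointwise

/-- The zonotope generated by the vectors `v i`: the Minkowski sum of the segments from `0` to
`v i` (the empty sum is `{0}`). -/
def zonotope {n : ℕ} (v : Fin n → EuclideanSpace ℝ (Fin 3)) : Set (EuclideanSpace ℝ (Fin 3)) :=
  ∑ i, segment ℝ 0 (v i)

/-- The translates `l + P`, `l ∈ Λ`, form a tiling of `ℝ³` at level `k`: the set `Λ` is discrete
(it has finitely many points in every bounded region) and almost every point of space lies in
exactly `k` of the translates. -/
def IsTilingAtLevel (k : ℕ) (P Λ : Set (EuclideanSpace ℝ (Fin 3))) : Prop :=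
  (∀ R : ℝ, (Λ ∩ Metric.closedBall 0 R).Finite) ∧
    ∀ᵐ x ∂(volume : Measure (EuclideanSpace ℝ (Fin 3))), {l ∈ Λ | x ∈ l +ᵥ P}.encard = k

/-- `Λ` is a finite union of translated lattices. A lattice is a discrete additive subgroup of
`ℝ³`, of any rank; the lattices of the union may have different ranks and the translates may
overlap. -/
def IsFiniteUnionOfTranslatedLattices (Λ : Set (EuclideanSpace ℝ (Fin 3))) : Prop :=
  ∃ (N : ℕ) (a : Fin N → EuclideanSpace ℝ (Fin 3))
    (L : Fin N → AddSubgroup (EuclideanSpace ℝ (Fin 3))),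
    (∀ i, DiscreteTopology (L i)) ∧ Λ = ⋃ i, a i +ᵥ (L i : Set (EuclideanSpace ℝ (Fin 3)))

/-!
Let `G` be the group generated by all the vectors and `M ≤ G` the group generated by the `v i`.
For `G`-translates (or `M`-translates) of a Minkowski sum `Q`, adding a segment `[0, u]` with
`u ∈ G` to `Q` has a simple effect (`cosetCount_segment_add`): every line parallel to `u` that meets
`Q` gains exactly one point of each class modulo `ℤ u`. Hence the number of translates covering a
point grows by a function which is invariant along `ℝ u`, namely the number of translates, modulo
`ℤ u`, of the cylinder `Q + ℝ u` that contain the point.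

* Iterating this modulo larger and larger subspaces shows that the translates `g + P`, `g ∈ G`, form
  a tiling at some level `c` (`exists_ae_cosetCount_eq`); at the end of the recursion there are only
  translates of proper subspaces, which are null, and of the whole space.
* For nonzero `v i` and real numbers `r i`, the product of the difference operators in the
  directions `r i • v i` kills the covering function of the translates by `M`: each factor removes
  one segment `[0, v i]`, and what remains lies in translates of the plane `H₂`. Thus the translates
  of `P` by `M` and an even subset sum of the vectors `r i • v i` cover almost every point as often
  as those with an odd subset sum (`ae_sum_even_cosetCount_eq_sum_odd`).

For generic `r i` the subset sums `σ t` are distinct modulo `G`. The union of the sets `σ t + G` over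
all even subsets `t` is a tiling set, and it remains one when the pieces `σ t + M` with `t` even are
exchanged for those with `t` odd. The multiples of a generator `w j ∉ H₁` that lie in the resulting
set are exactly the nonzero ones, which is impossible for a finite union of cosets of subgroups
(`not_eq_iUnion_cosets_of_zmultiples`).
-/

/-! ### Segments and finite Minkowski sums of segments -/

section Geometry

variable {E : Type*} [NormedAddCommGroup E] [NormedSpace ℝ E]

lemma mem_segment_zero_add_iff {u x : E} {A : Set E} :
    x ∈ segment ℝ 0 u + A ↔ ∃ s : ℝ, 0 ≤ s ∧ s ≤ 1 ∧ x - s • u ∈ A := by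
  constructor
  · rintro ⟨p, hp, q, hq, rfl⟩
    rw [segment_eq_image'] at hp
    obtain ⟨s, ⟨hs0, hs1⟩, rfl⟩ := hp
    refine ⟨s, hs0, hs1, ?_⟩
    simpa using hq
  · rintro ⟨s, hs0, hs1, h⟩
    refine ⟨s • u, ?_, _, h, by simp⟩
    rw [segment_eq_image']
    exact ⟨s, ⟨hs0, hs1⟩, by simp⟩

lemma isCompact_sum_segment {ι : Type*} (s : Finset ι) (u : ι → E) :
    IsCompact (∑ i ∈ s, segment ℝ 0 (u i)) := by
  classical
  induction s using Finset.induction_on with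
  | empty => simp
  | insert a s ha ih =>
    rw [Finset.sum_insert ha]
    refine IsCompact.add ?_ ih
    rw [segment_eq_image']
    exact isCompact_Icc.image (by fun_prop)

lemma convex_sum_segment {ι : Type*} (s : Finset ι) (u : ι → E) :
    Convex ℝ (∑ i ∈ s, segment ℝ 0 (u i)) := by
  classical
  induction s using Finset.induction_on with
  | empty =>
    rw [Finset.sum_empty]
    exact convex_singleton 0
  | insert a s ha ih =>
    rw [Finset.sum_insert ha]
    exact (convex_segment _ _).add ih

lemma sum_segment_subset_submodule {ι : Type*} (s : Finset ι) (u : ι → E) (W : Submodule ℝ E)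
    (hu : ∀ i ∈ s, u i ∈ W) : ∑ i ∈ s, segment ℝ 0 (u i) ⊆ (W : Set E) := by
  classical
  induction s using Finset.induction_on with
  | empty => simp
  | insert a s ha ih =>
    rw [Finset.sum_insert ha]
    intro x hx
    obtain ⟨t, -, -, h⟩ := mem_segment_zero_add_iff.1 hx
    have h1 := ih (fun i hi => hu i (Finset.mem_insert_of_mem hi)) h
    have h2 := W.add_mem h1 (W.smul_mem t (hu a (Finset.mem_insert_self a s)))
    simpa using h2

/-- A line transversal to `W` meets `Q + W` (`Q` compact and convex) in a segment. Written with
the parameter of the line decreasing along `u`, adding `[0, u]` to `Q` prolongs this segment by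
exactly one half-open unit interval, and therefore by exactly one point of each class modulo
`ℤ u`. -/
lemma exists_prolongation_eq_Ico [FiniteDimensional ℝ E] {Q : Set E} (hQ : IsCompact Q)
    (hQc : Convex ℝ Q) {W : Submodule ℝ E} {u : E} (hu : u ∉ W) (y : E)
    (hne : ∃ t : ℝ, y - t • u ∈ Q + (W : Set E)) :
    ∃ a : ℝ, ∀ t : ℝ, (y - t • u ∈ segment ℝ 0 u + Q + (W : Set E) ∧
      y - t • u ∉ Q + (W : Set E)) ↔ a - 1 ≤ t ∧ t < a := by
  set J : Set ℝ := {t | y - t • u ∈ Q + (W : Set E)} with hJ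
  have hclosed : IsClosed J := by
    have h1 : IsClosed (Q + (W : Set E)) :=
      (Submodule.closed_of_finiteDimensional W).add_left_of_isCompact hQ
    exact h1.preimage (by fun_prop)
  have hconv : Convex ℝ J := by
    intro s hs t ht p q hp hq hpq
    have := (hQc.add W.convex) hs ht hp hq hpq
    have e : p • (y - s • u) + q • (y - t • u) = y - (p • s + q • t) • u := by
      have : y = (p + q) • y := by rw [hpq, one_smul]
      conv_rhs => rw [this]
      simp only [smul_eq_mul]
      module
    rw [e] at this
    exact this
  have hbdd : BddBelow J := by
    obtain ⟨f, hfu, hf⟩ := Submodule.exists_le_ker_of_notMem hu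
    have hfc : Continuous f := f.continuous_of_finiteDimensional
    have hcomp : IsCompact ((fun q => (f y - f q) / f u) '' Q) := hQ.image (by fun_prop)
    refine hcomp.bddBelow.mono ?_
    rintro t ⟨q, hq, w, hw, hqw⟩
    refine ⟨q, hq, ?_⟩
    have hw0 : f w = 0 := hf hw
    have := congrArg f hqw
    simp only [map_add, map_sub, map_smul, hw0, smul_eq_mul] at this
    simp only
    rw [div_eq_iff hfu]
    linarith
  have hmem : sInf J ∈ J := hclosed.csInf_mem hne hbdd
  refine ⟨sInf J, fun t => ?_⟩
  have hiff : y - t • u ∈ segment ℝ 0 u + Q + (W : Set E) ↔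
      ∃ s : ℝ, 0 ≤ s ∧ s ≤ 1 ∧ t + s ∈ J := by
    rw [add_assoc, mem_segment_zero_add_iff]
    have : ∀ s : ℝ, y - t • u - s • u = y - (t + s) • u := fun s => by module
    simp only [this]
    rfl
  rw [hiff]
  constructor
  · rintro ⟨⟨s, hs0, hs1, hs⟩, hn⟩
    have h1 : sInf J ≤ t + s := csInf_le hbdd hs
    refine ⟨by linarith, ?_⟩
    by_contra! h
    exact hn (hconv.ordConnected.out hmem hs ⟨h, by linarith⟩)
  · rintro ⟨h1, h2⟩
    refine ⟨⟨sInf J - t, by linarith, by linarith, by simpa using hmem⟩, fun h => ?_⟩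
    exact absurd (csInf_le hbdd h) (not_le.2 h2)

/-! ### Counting translates modulo a subgroup -/

/-- The number of classes `g + K`, `g ∈ G`, such that `x` lies in the translate of `Q + W` by `g`.
It is used for `K ≤ W`, when the condition depends only on the class of `g`. -/
noncomputable def cosetCount (G K : AddSubgroup E) (W : Submodule ℝ E) (Q : Set E) (x : E) : ℕ∞ :=
  ((QuotientAddGroup.mk : E → E ⧸ K) '' {g | g ∈ G ∧ x - g ∈ Q + (W : Set E)}).encard

lemma cosetCount_bot (G : AddSubgroup E) (Q : Set E) (x : E) :
    cosetCount G ⊥ ⊥ Q x = {g | g ∈ G ∧ x - g ∈ Q}.encard := by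
  unfold cosetCount
  rw [Set.InjOn.encard_image]
  · simp
  · intro a _ b _ h
    rw [QuotientAddGroup.eq, AddSubgroup.mem_bot] at h
    exact (neg_add_eq_zero.1 h)

lemma cosetCount_segment_add_of_mem {G K : AddSubgroup E} {W : Submodule ℝ E} {Q : Set E} {u : E}
    (hu : u ∈ W) (x : E) :
    cosetCount G K W (segment ℝ 0 u + Q) x = cosetCount G K W Q x := by
  have : segment ℝ 0 u + Q + (W : Set E) = Q + (W : Set E) := by
    ext z
    rw [add_assoc, mem_segment_zero_add_iff]
    constructor
    · rintro ⟨s, -, -, q, hq, w, hw, h⟩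
      exact ⟨q, hq, w + s • u, W.add_mem hw (W.smul_mem s hu),
        by simp only at h ⊢; rw [← add_assoc, h]; abel⟩
    · intro h
      exact ⟨0, le_rfl, zero_le_one, by simpa using h⟩
  unfold cosetCount
  rw [this]

/-- Translating by an element of the line `ℝ u` does not change the count for `Q + ℝ u`. -/
lemma cosetCount_sub_smul (G K : AddSubgroup E) {W : Submodule ℝ E} (Q : Set E) {u : E}
    (hu : u ∈ W) (r : ℝ) (x : E) :
    cosetCount G K W Q (x - r • u) = cosetCount G K W Q x := by
  have key : ∀ (r : ℝ) (z : E), z ∈ Q + (W : Set E) → z - r • u ∈ Q + (W : Set E) := by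
    rintro r z ⟨q, hq, w, hw, rfl⟩
    exact ⟨q, hq, w - r • u, W.sub_mem hw (W.smul_mem r hu), by simp only; abel⟩
  have : ∀ g, x - r • u - g ∈ Q + (W : Set E) ↔ x - g ∈ Q + (W : Set E) := by
    intro g
    constructor
    · intro h
      have := key (-r) _ h
      rwa [show x - r • u - g - (-r) • u = x - g by module] at this
    · intro h
      have := key r _ h
      rwa [show x - g - r • u = x - r • u - g by abel] at this
  unfold cosetCount
  simp only [this]

/-- Adding the segment `[0, u]` to `Q` adds to the count modulo `K` the count of the cylinders
`Q + W + ℝ u` modulo `K + ℤ u`: each such cylinder containing `x` accounts for exactly one new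
class modulo `K`. -/
lemma cosetCount_segment_add [FiniteDimensional ℝ E] {G K : AddSubgroup E} {W : Submodule ℝ E}
    (hKW : ∀ k ∈ K, k ∈ W) {Q : Set E} (hQ : IsCompact Q) (hQc : Convex ℝ Q) {u : E}
    (huG : u ∈ G) (huW : u ∉ W) (x : E) :
    cosetCount G K W (segment ℝ 0 u + Q) x = cosetCount G K W Q x +
      cosetCount G (K ⊔ AddSubgroup.zmultiples u) (W ⊔ Submodule.span ℝ {u}) Q x := by
  have hinv : ∀ (A : Set E) (z k : E), k ∈ K → z ∈ A + (W : Set E) →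
      z + k ∈ A + (W : Set E) := by
    rintro A _ k hk ⟨q, hq, w, hw, rfl⟩
    exact ⟨q, hq, w + k, W.add_mem hw (hKW k hk), by simp only; abel⟩
  set S : Set E := {g | g ∈ G ∧ x - g ∈ Q + (W : Set E)} with hS
  set S' : Set E := {g | g ∈ G ∧ x - g ∈ segment ℝ 0 u + Q + (W : Set E)} with hS'
  set D : Set E := {g | g ∈ G ∧ (x - g ∈ segment ℝ 0 u + Q + (W : Set E) ∧
    x - g ∉ Q + (W : Set E))} with hD
  set π : E → E ⧸ K := QuotientAddGroup.mk with hπ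
  set π' : E → E ⧸ (K ⊔ AddSubgroup.zmultiples u) := QuotientAddGroup.mk with hπ'
  have hSS' : S ⊆ S' := by
    rintro g ⟨hg, h⟩
    refine ⟨hg, ?_⟩
    rw [add_assoc, mem_segment_zero_add_iff]
    exact ⟨0, le_rfl, zero_le_one, by simpa using h⟩
  have hunion : π '' S' = π '' S ∪ π '' D := by
    rw [← Set.image_union]
    congr 1
    ext g
    constructor
    · rintro ⟨hg, h⟩
      by_cases h' : x - g ∈ Q + (W : Set E)
      · exact Or.inl ⟨hg, h'⟩
      · exact Or.inr ⟨hg, h, h'⟩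
    · rintro (h | h)
      · exact hSS' h
      · exact ⟨h.1, h.2.1⟩
  have hdisj : Disjoint (π '' S) (π '' D) := by
    rw [Set.disjoint_left]
    rintro _ ⟨g, hg, rfl⟩ ⟨d, hd, h⟩
    rw [hπ, QuotientAddGroup.eq] at h
    apply hd.2.2
    have := hinv Q _ _ h hg.2
    rwa [show x - g + (-d + g) = x - d by abel] at this
  have hline : ∀ g, x - g ∈ Q + ((W ⊔ Submodule.span ℝ {u} : Submodule ℝ E) : Set E) ↔
      ∃ t : ℝ, x - g - t • u ∈ Q + (W : Set E) := by
    intro g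
    constructor
    · rintro ⟨q, hq, w', hw', h⟩
      obtain ⟨w, hw, v, hv, rfl⟩ := Submodule.mem_sup.1 hw'
      obtain ⟨t, rfl⟩ := Submodule.mem_span_singleton.1 hv
      exact ⟨t, q, hq, w, hw, by simp only at h ⊢; rw [← h]; abel⟩
    · rintro ⟨t, q, hq, w, hw, h⟩
      exact ⟨q, hq, w + t • u, Submodule.add_mem_sup hw
        (Submodule.smul_mem _ _ (Submodule.mem_span_singleton_self u)),
        by simp only at h ⊢; rw [← add_assoc, h]; abel⟩
  -- A class modulo `K + ℤ u` is split into classes modulo `K`; exactly one of them is new.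
  have himage : (π '' D).encard = (π' '' {g | g ∈ G ∧ x - g ∈
      Q + ((W ⊔ Submodule.span ℝ {u} : Submodule ℝ E) : Set E)}).encard := by
    set φ : E ⧸ K →+ E ⧸ (K ⊔ AddSubgroup.zmultiples u) :=
      QuotientAddGroup.map _ _ (AddMonoidHom.id E) (by simp) with hφ
    have hφπ : ∀ g, φ (π g) = π' g := fun g => rfl
    have him : φ '' (π '' D) = π' '' {g | g ∈ G ∧ x - g ∈
        Q + ((W ⊔ Submodule.span ℝ {u} : Submodule ℝ E) : Set E)} := by
      rw [Set.image_image]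
      simp only [hφπ]
      ext c
      constructor
      · rintro ⟨g, ⟨hg, h, -⟩, rfl⟩
        refine ⟨g, ⟨hg, ?_⟩, rfl⟩
        rw [hline g]
        rw [add_assoc, mem_segment_zero_add_iff] at h
        obtain ⟨s, -, -, h⟩ := h
        exact ⟨s, h⟩
      · rintro ⟨g, ⟨hg, h⟩, rfl⟩
        obtain ⟨a, ha⟩ := exists_prolongation_eq_Ico hQ hQc huW (x - g) ((hline g).1 h)
        have h1 := (ha ((⌈a⌉ - 1 : ℤ) : ℝ)).2 (by
          push_cast
          exact ⟨by linarith [Int.le_ceil a], by linarith [Int.ceil_lt_add_one a]⟩)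
        have e : x - g - ((⌈a⌉ - 1 : ℤ) : ℝ) • u = x - (g + (⌈a⌉ - 1 : ℤ) • u) := by
          rw [Int.cast_smul_eq_zsmul]; abel
        rw [e] at h1
        refine ⟨_, ⟨G.add_mem hg (G.zsmul_mem huG _), h1⟩, ?_⟩
        rw [hπ', QuotientAddGroup.eq]
        refine AddSubgroup.mem_sup_right ?_
        rw [show -(g + (⌈a⌉ - 1) • u) + g = (-(⌈a⌉ - 1)) • u by rw [neg_smul]; abel]
        exact AddSubgroup.zsmul_mem_zmultiples u _
    rw [← him]
    refine (Set.InjOn.encard_image ?_).symm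
    rintro _ ⟨g, hg, rfl⟩ _ ⟨d, hd, rfl⟩ h
    rw [hφπ, hφπ, hπ', QuotientAddGroup.eq] at h
    obtain ⟨k, hk, z, hz, hkz⟩ := AddSubgroup.mem_sup.1 h
    obtain ⟨j, rfl⟩ := AddSubgroup.mem_zmultiples_iff.1 hz
    have hne : ∃ t : ℝ, x - g - t • u ∈ Q + (W : Set E) := by
      have := hg.2.1
      rw [add_assoc, mem_segment_zero_add_iff] at this
      obtain ⟨s, -, -, h⟩ := this
      exact ⟨s, h⟩
    obtain ⟨a, ha⟩ := exists_prolongation_eq_Ico hQ hQc huW (x - g) hne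
    have h0 := (ha 0).1 (by simpa using hg.2)
    have ed : x - g - (j : ℝ) • u = x - d + k := by
      rw [Int.cast_smul_eq_zsmul]
      have : d = g + (k + j • u) := by rw [hkz]; abel
      rw [this]; abel
    have hj := (ha j).1 (by
      rw [ed]
      refine ⟨hinv _ _ _ hk hd.2.1, fun hc => hd.2.2 ?_⟩
      have := hinv _ _ _ (K.neg_mem hk) hc
      simpa using this)
    have hj0 : j = 0 := by
      have h3 : ((j : ℤ) : ℝ) < 1 := by linarith
      have h4 : (-1 : ℝ) < ((j : ℤ) : ℝ) := by linarith
      have h5 : j < 1 := by exact_mod_cast h3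
      have h6 : -1 < j := by exact_mod_cast h4
      omega
    rw [hπ, QuotientAddGroup.eq, ← hkz, hj0]
    simpa using hk
  unfold cosetCount
  rw [← himage, ← Set.encard_union_eq hdisj, ← hunion]

end Geometry

/-! ### Tilings by the generated group -/

section Tiling

variable {E : Type*} [NormedAddCommGroup E] [NormedSpace ℝ E] [FiniteDimensional ℝ E]
  [MeasurableSpace E] [BorelSpace E] {μ : Measure E} [μ.IsAddHaarMeasure]

lemma ae_sub_right {E : Type*} [NormedAddCommGroup E] [MeasurableSpace E] [BorelSpace E]
    {μ : Measure E} [μ.IsAddHaarMeasure] {p : E → Prop} (h : ∀ᵐ x ∂μ, p x) (a : E) :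
    ∀ᵐ x ∂μ, p (x - a) :=
  (measurePreserving_sub_right μ a).quasiMeasurePreserving.ae h

lemma ae_forall_sub_notMem_submodule {G : AddSubgroup E} [Countable G] {W : Submodule ℝ E}
    (hW : W ≠ ⊤) : ∀ᵐ x ∂μ, ∀ g ∈ G, x - g ∉ W := by
  have h : ∀ᵐ x ∂μ, x ∉ W := by
    have := Measure.addHaar_submodule μ W hW
    rw [ae_iff]
    simpa using this
  have h2 : ∀ᵐ x ∂μ, ∀ g : G, x - (g : E) ∉ W := ae_all_iff.2 fun g => ae_sub_right h (g : E)
  filter_upwards [h2] with x hx g hg using hx ⟨g, hg⟩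

/-- The translates of a zonotope by a countable group containing its generators cover almost every
point equally often, also when everything is taken modulo a subspace `W` and a subgroup of `W`. -/
theorem exists_ae_cosetCount_eq {G : AddSubgroup E} [Countable G] {ι : Type*} (s : Finset ι)
    (u : ι → E) (hu : ∀ i, u i ∈ G) (K : AddSubgroup E) (W : Submodule ℝ E)
    (hKW : ∀ k ∈ K, k ∈ W) :
    ∃ c : ℕ∞, ∀ᵐ x ∂μ, cosetCount G K W (∑ i ∈ s, segment ℝ 0 (u i)) x = c := by
  classical
  induction s using Finset.induction_on generalizing K W with
  | empty =>
    by_cases hW : W = ⊤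
    · refine ⟨((QuotientAddGroup.mk : E → E ⧸ K) '' (G : Set E)).encard,
        Filter.Eventually.of_forall fun x => ?_⟩
      subst hW
      simp [cosetCount]
    · refine ⟨0, ?_⟩
      filter_upwards [ae_forall_sub_notMem_submodule (G := G) hW] with x hx
      unfold cosetCount
      rw [Set.encard_eq_zero, Set.image_eq_empty, Set.eq_empty_iff_forall_notMem]
      rintro g ⟨hg, h⟩
      exact hx g hg (by simpa using h)
  | insert a s ha ih =>
    rw [Finset.sum_insert ha]
    by_cases haW : u a ∈ W
    · simp only [cosetCount_segment_add_of_mem haW]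
      exact ih K W hKW
    · obtain ⟨c₁, h₁⟩ := ih K W hKW
      obtain ⟨c₂, h₂⟩ := ih (K ⊔ AddSubgroup.zmultiples (u a)) (W ⊔ Submodule.span ℝ {u a}) (by
        intro k hk
        obtain ⟨k, hkK, z, hz, rfl⟩ := AddSubgroup.mem_sup.1 hk
        obtain ⟨j, rfl⟩ := AddSubgroup.mem_zmultiples_iff.1 hz
        exact Submodule.add_mem_sup (hKW k hkK)
          (zsmul_mem (Submodule.mem_span_singleton_self (u a)) j))
      refine ⟨c₁ + c₂, ?_⟩
      filter_upwards [h₁, h₂] with x hx₁ hx₂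
      rw [cosetCount_segment_add hKW (isCompact_sum_segment s u) (convex_sum_segment s u) (hu a)
        haW, hx₁, hx₂]

/-! ### Cancellation along the generators -/

/-- Let `M` contain the nonzero vectors `v i`, and translate `∑ i ∈ s, [0, v i] + Q` by `M` and
further by the subset sums of the vectors `r i • v i`. If `Q` is a zonotope whose generators do
not span, then almost every point is covered equally often with the even and with the odd subset
sums. Indeed, the summand `[0, v a]` contributes a function invariant along `v a`, which is killed
by the difference operator in the direction `r a • v a`. -/
theorem ae_sum_even_cosetCount_eq_sum_odd {M : AddSubgroup E} [Countable M] {ι κ : Type*}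
    [DecidableEq ι] (s : Finset ι) (v : ι → E) (hv : ∀ i ∈ s, v i ∈ M) (hv0 : ∀ i ∈ s, v i ≠ 0)
    (q : Finset κ) (w : κ → E) (W : Submodule ℝ E) (hW : W ≠ ⊤) (hw : ∀ j ∈ q, w j ∈ W)
    (r : ι → ℝ) :
    ∀ᵐ x ∂μ,
      ∑ t ∈ s.powerset, (if Even t.card then cosetCount M ⊥ ⊥
        (∑ i ∈ s, segment ℝ 0 (v i) + ∑ j ∈ q, segment ℝ 0 (w j))
          (x - ∑ i ∈ t, r i • v i) else 0) =
      ∑ t ∈ s.powerset, (if Even t.card then 0 else cosetCount M ⊥ ⊥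
        (∑ i ∈ s, segment ℝ 0 (v i) + ∑ j ∈ q, segment ℝ 0 (w j))
          (x - ∑ i ∈ t, r i • v i)) := by
  induction s using Finset.induction_on with
  | empty =>
    filter_upwards [ae_forall_sub_notMem_submodule (G := M) hW] with x hx
    have : {g | g ∈ M ∧ x - g ∈ ∑ j ∈ q, segment ℝ 0 (w j)} = ∅ := by
      rw [Set.eq_empty_iff_forall_notMem]
      rintro g ⟨hg, h⟩
      exact hx g hg (sum_segment_subset_submodule q w W hw h)
    simp [cosetCount_bot, this]
  | insert a s ha ih =>
    have ih' := ih (fun i hi => hv i (Finset.mem_insert_of_mem hi))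
      (fun i hi => hv0 i (Finset.mem_insert_of_mem hi))
    filter_upwards [ih', ae_sub_right ih' (r a • v a)] with x h₁ h₂
    set Q : Set E := ∑ i ∈ s, segment ℝ 0 (v i) + ∑ j ∈ q, segment ℝ 0 (w j) with hQ
    set F := cosetCount M ⊥ ⊥ Q with hF
    set g := cosetCount M (⊥ ⊔ AddSubgroup.zmultiples (v a)) (⊥ ⊔ Submodule.span ℝ {v a}) Q
      with hg
    have hstep : ∀ y, cosetCount M ⊥ ⊥ (∑ i ∈ insert a s, segment ℝ 0 (v i) +
        ∑ j ∈ q, segment ℝ 0 (w j)) y = F y + g y := by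
      intro y
      rw [Finset.sum_insert ha, add_assoc]
      exact cosetCount_segment_add (by simp)
        ((isCompact_sum_segment s v).add (isCompact_sum_segment q w))
        ((convex_sum_segment s v).add (convex_sum_segment q w))
        (hv a (Finset.mem_insert_self a s))
        (by simpa using hv0 a (Finset.mem_insert_self a s)) y
    have hginv : ∀ y, g (y - r a • v a) = g y := fun y =>
      cosetCount_sub_smul _ _ _ (Submodule.mem_sup_right
        (Submodule.mem_span_singleton_self (v a))) _ _
    simp only [hstep]
    rw [Finset.sum_powerset_insert ha, Finset.sum_powerset_insert ha]
    have hcard : ∀ t ∈ s.powerset, (insert a t).card = t.card + 1 := fun t ht =>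
      Finset.card_insert_of_notMem fun h => ha (Finset.mem_powerset.1 ht h)
    have hsum : ∀ t ∈ s.powerset, x - ∑ i ∈ insert a t, r i • v i =
        x - r a • v a - ∑ i ∈ t, r i • v i := fun t ht => by
      rw [Finset.sum_insert fun h => ha (Finset.mem_powerset.1 ht h)]; abel
    have hgt : ∀ t : Finset ι, g (x - r a • v a - ∑ i ∈ t, r i • v i) =
        g (x - ∑ i ∈ t, r i • v i) := fun t => by
      rw [← hginv (x - ∑ i ∈ t, r i • v i)]; congr 1; abel
    have e₁ : ∑ t ∈ s.powerset, (if Even (insert a t).card then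
          F (x - ∑ i ∈ insert a t, r i • v i) + g (x - ∑ i ∈ insert a t, r i • v i) else 0) =
        ∑ t ∈ s.powerset, (if Even t.card then 0 else F (x - r a • v a - ∑ i ∈ t, r i • v i)) +
        ∑ t ∈ s.powerset, (if Even t.card then 0 else g (x - ∑ i ∈ t, r i • v i)) := by
      rw [← Finset.sum_add_distrib]
      refine Finset.sum_congr rfl fun t ht => ?_
      rw [hcard t ht, hsum t ht, hgt]
      by_cases h : Even t.card <;> simp [h, Nat.even_add_one]
    have e₂ : ∑ t ∈ s.powerset, (if Even (insert a t).card then 0 else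
          F (x - ∑ i ∈ insert a t, r i • v i) + g (x - ∑ i ∈ insert a t, r i • v i)) =
        ∑ t ∈ s.powerset, (if Even t.card then F (x - r a • v a - ∑ i ∈ t, r i • v i) else 0) +
        ∑ t ∈ s.powerset, (if Even t.card then g (x - ∑ i ∈ t, r i • v i) else 0) := by
      rw [← Finset.sum_add_distrib]
      refine Finset.sum_congr rfl fun t ht => ?_
      rw [hcard t ht, hsum t ht, hgt]
      by_cases h : Even t.card <;> simp [h, Nat.even_add_one]
    have e₃ : ∑ t ∈ s.powerset, (if Even t.card then
          F (x - ∑ i ∈ t, r i • v i) + g (x - ∑ i ∈ t, r i • v i) else 0) =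
        ∑ t ∈ s.powerset, (if Even t.card then F (x - ∑ i ∈ t, r i • v i) else 0) +
        ∑ t ∈ s.powerset, (if Even t.card then g (x - ∑ i ∈ t, r i • v i) else 0) := by
      rw [← Finset.sum_add_distrib]
      refine Finset.sum_congr rfl fun t ht => ?_
      by_cases h : Even t.card <;> simp [h]
    have e₄ : ∑ t ∈ s.powerset, (if Even t.card then 0 else
          F (x - ∑ i ∈ t, r i • v i) + g (x - ∑ i ∈ t, r i • v i)) =
        ∑ t ∈ s.powerset, (if Even t.card then 0 else F (x - ∑ i ∈ t, r i • v i)) +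
        ∑ t ∈ s.powerset, (if Even t.card then 0 else g (x - ∑ i ∈ t, r i • v i)) := by
      rw [← Finset.sum_add_distrib]
      refine Finset.sum_congr rfl fun t ht => ?_
      by_cases h : Even t.card <;> simp [h]
    rw [e₁, e₂, e₃, e₄, h₁, h₂]
    abel

end Tiling

/-! ### Subset sums that are distinct modulo a countable group -/

/-- Nonzero vectors can be rescaled so that their subset sums become pairwise distinct modulo a
countable group: at each step only countably many scalars are excluded. -/
lemma exists_smul_subset_sums_injOn {E : Type*} [AddCommGroup E] [Module ℝ E] (G : AddSubgroup E)
    [Countable G] {ι : Type*} [DecidableEq ι] (s : Finset ι) (v : ι → E)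
    (hv : ∀ i ∈ s, v i ≠ 0) :
    ∃ r : ι → ℝ, ∀ t ⊆ s, ∀ t' ⊆ s, ∑ i ∈ t, r i • v i - ∑ i ∈ t', r i • v i ∈ G → t = t' := by
  induction s using Finset.induction_on with
  | empty =>
    refine ⟨0, fun t ht t' ht' _ => ?_⟩
    rw [Finset.subset_empty.1 ht, Finset.subset_empty.1 ht']
  | insert a s ha ih =>
    obtain ⟨r, hr⟩ := ih fun i hi => hv i (Finset.mem_insert_of_mem hi)
    have hva : v a ≠ 0 := hv a (Finset.mem_insert_self a s)
    set C : Set E := ⋃ p ∈ (s.powerset ×ˢ s.powerset : Finset (Finset ι × Finset ι)),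
      (fun g => g + (∑ i ∈ p.1, r i • v i - ∑ i ∈ p.2, r i • v i)) '' (G : Set E) with hC
    have hCc : C.Countable := by
      refine Set.Countable.biUnion (Finset.countable_toSet _) fun p _ => Set.Countable.image ?_ _
      exact Set.countable_coe_iff.1 ‹_›
    have hpre : {ρ : ℝ | ρ • v a ∈ C}.Countable :=
      hCc.preimage (f := fun ρ : ℝ => ρ • v a) (smul_left_injective ℝ hva)
    obtain ⟨ρ, hρ⟩ : ∃ ρ : ℝ, ρ • v a ∉ C := by
      by_contra! h
      exact Set.not_countable_univ (α := ℝ) (hpre.mono fun ρ _ => h ρ)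
    have hnot : ∀ t ⊆ s, ∀ t' ⊆ s,
        ρ • v a + ∑ i ∈ t, r i • v i - ∑ i ∈ t', r i • v i ∉ G := by
      intro t ht t' ht' h
      refine hρ (Set.mem_iUnion₂.2 ⟨(t', t), by simp [ht, ht'], _, h, ?_⟩)
      simp only
      abel
    have hupd : ∀ t ⊆ s, ∑ i ∈ t, Function.update r a ρ i • v i = ∑ i ∈ t, r i • v i := by
      intro t ht
      refine Finset.sum_congr rfl fun i hi => ?_
      rw [Function.update_of_ne]
      rintro rfl
      exact ha (ht hi)
    -- A subset of `insert a s` is a subset of `s`, or `a` together with one.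
    have hsplit : ∀ t ⊆ insert a s, (t ⊆ s ∧ ∑ i ∈ t, Function.update r a ρ i • v i =
        ∑ i ∈ t, r i • v i) ∨ ∃ t₀ ⊆ s, t = insert a t₀ ∧
          ∑ i ∈ t, Function.update r a ρ i • v i = ρ • v a + ∑ i ∈ t₀, r i • v i := by
      intro t ht
      by_cases hat : a ∈ t
      · right
        have h0 : t.erase a ⊆ s := by
          rwa [← Finset.subset_insert_iff]
        refine ⟨t.erase a, h0, (Finset.insert_erase hat).symm, ?_⟩
        rw [← hupd _ h0, ← Finset.add_sum_erase t _ hat, Function.update_self]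
      · have h0 : t ⊆ s := (Finset.subset_insert_iff_of_notMem hat).1 ht
        exact Or.inl ⟨h0, hupd t h0⟩
    refine ⟨Function.update r a ρ, fun t ht t' ht' h => ?_⟩
    rcases hsplit t ht with ⟨h1, e1⟩ | ⟨t₀, h1, rfl, e1⟩ <;>
      rcases hsplit t' ht' with ⟨h2, e2⟩ | ⟨t₁, h2, rfl, e2⟩ <;> rw [e1, e2] at h
    · exact hr t h1 t' h2 h
    · exfalso
      refine hnot t₁ h2 t h1 ?_
      rw [← neg_mem_iff]
      convert h using 1
      abel
    · exact absurd h (hnot t₀ h1 t' h2)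
    · rw [hr t₀ h1 t₁ h2 (by convert h using 1; abel)]

/-! ### Unions of translates of subsets of a group -/

/-- If the vectors `σ t` are distinct modulo `G`, then counting the points of a union of translates
`σ t + L t`, `L t ⊆ G`, amounts to counting in each `L t` separately. -/
lemma encard_biUnion_translate {E : Type*} [AddCommGroup E] (G : AddSubgroup E) {τ : Type*}
    (T : Finset τ) (σ : τ → E) (hσ : ∀ t ∈ T, ∀ t' ∈ T, σ t - σ t' ∈ G → t = t')
    (L : τ → Set E) (hL : ∀ t, L t ⊆ G) (P : Set E) (x : E) :
    {l | (∃ t ∈ T, l - σ t ∈ L t) ∧ x - l ∈ P}.encard =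
      ∑ t ∈ T, {g | g ∈ L t ∧ x - σ t - g ∈ P}.encard := by
  classical
  induction T using Finset.induction_on with
  | empty => simp
  | insert a T ha ih =>
    rw [Finset.sum_insert ha, ← ih fun t ht t' ht' =>
      hσ t (Finset.mem_insert_of_mem ht) t' (Finset.mem_insert_of_mem ht')]
    rw [← (add_right_injective (σ a)).injOn.encard_image (s := {g | g ∈ L a ∧ x - σ a - g ∈ P}),
      ← Set.encard_union_eq]
    · congr 1
      ext l
      constructor
      · rintro ⟨⟨t, ht, h⟩, hx⟩
        rcases Finset.mem_insert.1 ht with rfl | ht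
        · exact Or.inl ⟨l - σ t, ⟨h, by convert hx using 1; abel⟩, by simp⟩
        · exact Or.inr ⟨⟨t, ht, h⟩, hx⟩
      · rintro (⟨g, ⟨hg, hx⟩, rfl⟩ | ⟨⟨t, ht, h⟩, hx⟩)
        · exact ⟨⟨a, Finset.mem_insert_self a T, by simpa using hg⟩,
            by convert hx using 1; simp only; abel⟩
        · exact ⟨⟨t, Finset.mem_insert_of_mem ht, h⟩, hx⟩
    · rw [Set.disjoint_left]
      rintro _ ⟨g, ⟨hg, -⟩, rfl⟩ ⟨⟨t, ht, h⟩, -⟩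
      refine ha ?_
      rw [hσ a (Finset.mem_insert_self a T) t (Finset.mem_insert_of_mem ht) ?_]
      · exact ht
      · have := G.sub_mem (hL t h) (hL a hg)
        convert this using 1
        simp only
        abel

/-- A set containing all nonzero multiples of `z` but not `0` is not a finite union of cosets of
subgroups. Among the multiples `k D z` of a suitable `D z`, two lie in the same coset, whose
subgroup then contains `D z` and whose coset then contains `0`. -/
lemma not_eq_iUnion_cosets_of_zmultiples {E : Type*} [AddCommGroup E] {Λ : Set E} {z : E}
    (h0 : (0 : E) ∉ Λ) (hz : ∀ k : ℕ, 0 < k → k • z ∈ Λ) (N : ℕ) (a : Fin N → E)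
    (L : Fin N → AddSubgroup E) : Λ ≠ ⋃ i, a i +ᵥ (L i : Set E) := by
  intro hΛ
  have hd : ∀ i, ∃ d : ℕ, 0 < d ∧ ((∃ e : ℕ, 0 < e ∧ e • z ∈ L i) → d • z ∈ L i) := by
    intro i
    by_cases h : ∃ e : ℕ, 0 < e ∧ e • z ∈ L i
    · obtain ⟨e, he, h'⟩ := h
      exact ⟨e, he, fun _ => h'⟩
    · exact ⟨1, one_pos, fun h' => absurd h' h⟩
  choose d hdpos hdL using hd
  set D : ℕ := ∏ i, d i with hD
  have hDpos : 0 < D := Finset.prod_pos fun i _ => hdpos i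
  have hmem : ∀ k : ℕ, ∃ i, ((k + 1) * D) • z - a i ∈ L i := by
    intro k
    have := hz ((k + 1) * D) (by positivity)
    rw [hΛ, Set.mem_iUnion] at this
    obtain ⟨i, y, hy, hyz⟩ := this
    refine ⟨i, ?_⟩
    rw [← hyz]
    simpa using hy
  choose c hc using hmem
  obtain ⟨k, k', hne, hkk⟩ := Finite.exists_ne_map_eq_of_infinite c
  wlog hlt : k < k' generalizing k k'
  · exact this k' k hne.symm hkk.symm (lt_of_le_of_ne (not_lt.1 hlt) hne.symm)
  set i := c k with hi
  have hk := hc k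
  have hk' := hc k'
  rw [← hkk] at hk'
  have hdiff : ((k' - k) * D) • z ∈ L i := by
    have h := (L i).sub_mem hk' hk
    have e : (k' + 1) * D = (k' - k) * D + (k + 1) * D := by
      rw [← add_mul]; congr 1; omega
    rw [e, add_smul] at h
    convert h using 1
    abel
  have hdi := hdL i ⟨_, Nat.mul_pos (Nat.sub_pos_of_lt hlt) hDpos, hdiff⟩
  have hDi : ((k + 1) * D) • z ∈ L i := by
    obtain ⟨e, he⟩ := Finset.dvd_prod_of_mem d (Finset.mem_univ i)
    rw [hD, he, mul_comm (d i) e, ← mul_assoc, mul_smul]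
    exact (L i).nsmul_mem hdi _
  apply h0
  rw [hΛ, Set.mem_iUnion]
  refine ⟨i, -a i, ?_, by simp⟩
  have := (L i).sub_mem hk hDi
  simpa using this

lemma AddSubgroup.finite_inter_isBounded {E : Type*} [NormedAddCommGroup E] [ProperSpace E]
    (G : AddSubgroup E) [DiscreteTopology G] {B : Set E} (hB : Bornology.IsBounded B) :
    (B ∩ (G : Set E)).Finite :=
  Metric.finite_isBounded_inter_isClosed (isDiscrete_iff_discreteTopology.2 ‹_›) hB
    AddSubgroup.isClosed_of_discrete

/-! ### The modified tiling -/

theorem mainTheorem3 (n m : ℕ)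
    (H₁ H₂ : Submodule ℝ (EuclideanSpace ℝ (Fin 3)))
    (hH₁ : Module.finrank ℝ H₁ = 2) (hH₂ : Module.finrank ℝ H₂ = 2) (hH : H₁ ≠ H₂)
    (v : Fin n → EuclideanSpace ℝ (Fin 3)) (w : Fin m → EuclideanSpace ℝ (Fin 3))
    (hv : ∀ i, v i ∈ H₁) (hw : ∀ j, w j ∈ H₂)
    (P : Set (EuclideanSpace ℝ (Fin 3))) (hP : P = zonotope v + zonotope w)
    (hPint : (interior P).Nonempty)
    (hdisc : DiscreteTopology (AddSubgroup.closure (Set.range v ∪ Set.range w)))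
    (hspan : Submodule.span ℝ (Set.range v) = H₁) :
    ∃ (k : ℕ) (Λ : Set (EuclideanSpace ℝ (Fin 3))),
      0 < k ∧ IsTilingAtLevel k P Λ ∧ ¬ IsFiniteUnionOfTranslatedLattices Λ := by
  classical
  set G : AddSubgroup (EuclideanSpace ℝ (Fin 3)) :=
    AddSubgroup.closure (Set.range v ∪ Set.range w) with hG
  set M : AddSubgroup (EuclideanSpace ℝ (Fin 3)) := AddSubgroup.closure (Set.range v) with hM
  have : Countable G := countable_of_Lindelof_of_discrete
  have hMG : M ≤ G := AddSubgroup.closure_mono Set.subset_union_left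
  have : Countable M := (AddSubgroup.inclusion_injective hMG).countable
  have hvM : ∀ i, v i ∈ M := fun i => AddSubgroup.subset_closure ⟨i, rfl⟩
  have hvG : ∀ i, v i ∈ G := fun i => hMG (hvM i)
  have hwG : ∀ j, w j ∈ G := fun j => AddSubgroup.subset_closure (Or.inr ⟨j, rfl⟩)
  have hMH : ∀ g ∈ M, g ∈ H₁ := fun g hg => by
    have : M ≤ H₁.toAddSubgroup := by
      rw [hM, AddSubgroup.closure_le]
      rintro _ ⟨i, rfl⟩
      exact hv i
    exact this hg
  have hneTop : ∀ H : Submodule ℝ (EuclideanSpace ℝ (Fin 3)), Module.finrank ℝ H = 2 →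
      H ≠ ⊤ := by
    rintro H h rfl
    simp at h
  have hPsum : P = ∑ i, segment ℝ 0 (v i) + ∑ j, segment ℝ 0 (w j) := hP
  have hPcompact : IsCompact P := by
    rw [hPsum]
    exact (isCompact_sum_segment _ v).add (isCompact_sum_segment _ w)
  have hPpos : volume P ≠ 0 := (Measure.measure_pos_of_nonempty_interior volume hPint).ne'
  -- Some `w j` is transversal to `H₁`, because `P` is not contained in that plane.
  obtain ⟨j, hj⟩ : ∃ j, w j ∉ H₁ := by
    by_contra! h
    refine hPpos (measure_mono_null ?_ (Measure.addHaar_submodule volume H₁ (hneTop H₁ hH₁)))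
    rw [hPsum]
    rintro _ ⟨a, ha, b, hb, rfl⟩
    exact H₁.add_mem (sum_segment_subset_submodule _ v H₁ (fun i _ => hv i) ha)
      (sum_segment_subset_submodule _ w H₁ (fun j _ => h j) hb)
  have hfin : ∀ x, {g | g ∈ G ∧ x - g ∈ P}.Finite := by
    intro x
    have hb : Bornology.IsBounded ((fun p => x - p) '' P) :=
      (hPcompact.image (by fun_prop)).isBounded
    refine (G.finite_inter_isBounded hb).subset ?_
    rintro g ⟨hg, h⟩
    exact ⟨⟨x - g, h, by simp⟩, hg⟩
  -- The translates of `P` by `G` form a tiling at a level `c`.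
  obtain ⟨c, hc⟩ : ∃ c : ℕ∞, ∀ᵐ x ∂(volume : Measure (EuclideanSpace ℝ (Fin 3))),
      {g | g ∈ G ∧ x - g ∈ P}.encard = c := by
    obtain ⟨c, hc⟩ := exists_ae_cosetCount_eq (μ := volume) (G := G) Finset.univ (Sum.elim v w)
      (by rintro (i | j) <;> simp [hvG, hwG]) ⊥ ⊥ (by simp)
    refine ⟨c, ?_⟩
    filter_upwards [hc] with x hx
    rw [← hx, cosetCount_bot, Fintype.sum_sum_type, hPsum]
    rfl
  have hctop : c ≠ ⊤ := by
    obtain ⟨x, hx⟩ := hc.exists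
    rw [← hx]
    exact (hfin x).encard_lt_top.ne
  have hc0 : c ≠ 0 := by
    rintro rfl
    apply hPpos
    rw [← compl_compl P, ← mem_ae_iff]
    filter_upwards [hc] with x hx hxP
    rw [Set.encard_eq_zero, Set.eq_empty_iff_forall_notMem] at hx
    exact hx 0 ⟨G.zero_mem, by simpa using hxP⟩
  lift c to ℕ using hctop
  set s : Finset (Fin n) := Finset.univ.filter fun i => v i ≠ 0 with hs
  have hPs : P = ∑ i ∈ s, segment ℝ 0 (v i) + ∑ j, segment ℝ 0 (w j) := by
    rw [hPsum, hs, Finset.sum_filter_of_ne]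
    intro i _ hi h0
    exact hi (by rw [h0, segment_same]; rfl)
  obtain ⟨r, hr⟩ := exists_smul_subset_sums_injOn G s v (fun i hi => (Finset.mem_filter.1 hi).2)
  have halt := ae_sum_even_cosetCount_eq_sum_odd (μ := volume) (M := M) s v (fun i _ => hvM i)
    (fun i hi => (Finset.mem_filter.1 hi).2) Finset.univ w H₂ (hneTop H₂ hH₂) (fun j _ => hw j) r
  simp only [← hPs, cosetCount_bot] at halt
  set σ : Finset (Fin n) → EuclideanSpace ℝ (Fin 3) := fun t => ∑ i ∈ t, r i • v i with hσ
  set L : Finset (Fin n) → Set (EuclideanSpace ℝ (Fin 3)) := fun t =>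
    if Even t.card then {g | g ∈ G ∧ g ∉ M} else M with hL
  have hLG : ∀ t, L t ⊆ G := by
    intro t g hg
    simp only [hL] at hg
    split_ifs at hg
    · exact hg.1
    · exact hMG hg
  have hσ' : ∀ t ∈ s.powerset, ∀ t' ∈ s.powerset, σ t - σ t' ∈ G → t = t' :=
    fun t ht t' ht' h => hr t (Finset.mem_powerset.1 ht) t' (Finset.mem_powerset.1 ht') h
  set T : Finset (Finset (Fin n)) := s.powerset.filter fun t => Even t.card with hT
  have hTpos : 0 < T.card := Finset.card_pos.2 ⟨∅, by simp [hT]⟩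
  refine ⟨T.card * c, {l | ∃ t ∈ s.powerset, l - σ t ∈ L t},
    Nat.mul_pos hTpos (Nat.pos_of_ne_zero fun h => hc0 (by simp [h])), ⟨fun R => ?_, ?_⟩, ?_⟩
  · have hfinU : (⋃ t ∈ s.powerset, (fun g => σ t + g) ''
        (((fun l => l - σ t) '' Metric.closedBall 0 R) ∩ (G : Set _))).Finite := by
      refine Set.Finite.biUnion (Finset.finite_toSet _) fun t _ => Set.Finite.image _ ?_
      exact G.finite_inter_isBounded
        ((isCompact_closedBall _ _).image (by fun_prop)).isBounded
    refine hfinU.subset ?_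
    rintro l ⟨⟨t, ht, hl⟩, hlR⟩
    exact Set.mem_iUnion₂.2 ⟨t, ht, l - σ t, ⟨⟨l, hlR, rfl⟩, hLG t hl⟩, by simp⟩
  · have hcσ : ∀ᵐ x ∂(volume : Measure (EuclideanSpace ℝ (Fin 3))), ∀ t : Finset (Fin n),
        {g | g ∈ G ∧ x - σ t - g ∈ P}.encard = c := ae_all_iff.2 fun t => ae_sub_right hc (σ t)
    filter_upwards [hcσ, halt] with x hx hxalt
    have hset : {l | (∃ t ∈ s.powerset, l - σ t ∈ L t) ∧ x ∈ l +ᵥ P} =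
        {l | (∃ t ∈ s.powerset, l - σ t ∈ L t) ∧ x - l ∈ P} := by
      ext l
      refine and_congr Iff.rfl ?_
      rw [Set.mem_vadd_set_iff_neg_vadd_mem, vadd_eq_add, neg_add_eq_sub]
    change {l | (∃ t ∈ s.powerset, l - σ t ∈ L t) ∧ x ∈ l +ᵥ P}.encard = _
    rw [hset, encard_biUnion_translate G _ σ hσ' L hLG P x]
    have hMfin : ∑ t ∈ s.powerset, (if Even t.card then
        {g | g ∈ M ∧ x - σ t - g ∈ P}.encard else 0) ≠ ⊤ := by
      refine (WithTop.sum_lt_top.2 fun t _ => ?_).ne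
      split_ifs
      · exact ((hfin (x - σ t)).subset fun g hg => ⟨hMG hg.1, hg.2⟩).encard_lt_top
      · exact WithTop.coe_lt_top 0
    -- For even subsets, restoring the omitted translates by `M` gives all translates by `G`.
    have hkey : ∑ t ∈ s.powerset, {g | g ∈ L t ∧ x - σ t - g ∈ P}.encard +
        ∑ t ∈ s.powerset, (if Even t.card then {g | g ∈ M ∧ x - σ t - g ∈ P}.encard else 0) =
        ∑ t ∈ s.powerset, (if Even t.card then (c : ℕ∞) else 0) +
        ∑ t ∈ s.powerset, (if Even t.card then 0 else
          {g | g ∈ M ∧ x - σ t - g ∈ P}.encard) := by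
      rw [← Finset.sum_add_distrib, ← Finset.sum_add_distrib]
      refine Finset.sum_congr rfl fun t _ => ?_
      by_cases ht : Even t.card
      · simp only [hL, ht, if_true, add_zero]
        rw [← hx t, ← Set.encard_union_eq]
        · congr 1
          ext g
          constructor
          · rintro (⟨h, h'⟩ | ⟨h, h'⟩)
            · exact ⟨h.1, h'⟩
            · exact ⟨hMG h, h'⟩
          · rintro ⟨h, h'⟩
            by_cases hg : g ∈ M
            · exact Or.inr ⟨hg, h'⟩
            · exact Or.inl ⟨⟨h, hg⟩, h'⟩
        · rw [Set.disjoint_left]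
          rintro g ⟨h, -⟩ ⟨h', -⟩
          exact h.2 h'
      · simp [hL, ht]
    rw [← hxalt] at hkey
    rw [WithTop.add_right_cancel hMfin hkey, ← Finset.sum_filter, Finset.sum_const]
    simp [hT]
  · rintro ⟨N, a, K, -, hΛ⟩
    refine not_eq_iUnion_cosets_of_zmultiples (z := w j) ?_ (fun k hk => ?_) N a K hΛ
    · rintro ⟨t, ht, h⟩
      have ht0 : (∅ : Finset (Fin n)) = t :=
        hσ' ∅ (by simp) t ht (by simpa [hσ] using hLG t h)
      subst ht0
      simp [hL, hσ] at h
    · refine ⟨∅, by simp, ?_⟩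
      simp only [hL, hσ, Finset.card_empty, Even.zero, if_true, Finset.sum_empty, sub_zero]
      refine ⟨G.nsmul_mem (hwG j) k, fun h => hj ?_⟩
      have := hMH _ h
      rw [← Nat.cast_smul_eq_nsmul ℝ] at this
      exact (H₁.smul_mem_iff (by exact_mod_cast hk.ne')).1 this
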